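/- Fix an integer $d\ge 2$. Let $G_d$ be the complete graph on $d$ vertices, labelled by the residues modulo $d$, and let $G_d^n$ be the group of $n$-tuples of vertices under coordinatewise addition modulo $d$. Let $\Lambda_1,\dots,\Lambda_n$ be independent unit-rate marked Poisson processes on $[0,\infty)$ with marks uniformly distributed on $\{1,\dots,d-1\}$ (the marks being independent of each other and of the incident times), and let $X=X^{(n)}$ be the simple symmetric continuous-time random walk on $G_d^n$ with $X_0=\mathbf 0$ whose $i$-th coordinate is increased by $k$ (mod $d$) at each incident of $\Lambda_i$ with mark $k$. Let $\mathcal L(X_t)$ be the law of $X_t$, let $\pi_d$ be the uniform distribution on $G_d^n$, let $\|\mu-\nu\|_{\mathrm{TV}}=\sup_A|\mu(A)-\nu(A)|$, let $\Phi$ be the standard normal distribution function, and put $$T_d=\frac12\Bigl(\frac{d-1}{d}\Bigr)\log n .$$ Then for every fixed $\theta\in\mathbb R$, as $n\to\infty$, $$\bigl\|\mathcal L(X_{T_d+\theta})-\pi_d\bigr\|_{\mathrm{TV}}=2\Phi\Bigl(\frac{\sqrt{d-1}}{2}\,e^{-d\theta/(d-1)}\Bigr)-1+o(1)$$ (where $T_d+\theta\ge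 0$ for all large $n$). Moreover the distance to $\pi_d$ exhibits a cutoff at time $T_d$: as $n\to\infty$, $\|\mathcal L(X_{cT_d})-\pi_d\|_{\mathrm{TV}}\to 1$ for every fixed $0<c<1$, and $\|\mathcal L(X_{cT_d})-\pi_d\|_{\mathrm{TV}}\to 0$ for every fixed $c>1$. -/

import Mathlib

open MeasureTheory ProbabilityTheory Filter Topology
open scoped NNReal

noncomputable section

namespace CompleteGraphWalk

/-- Total variation distance of two probability measures:
`‖μ - ν‖_TV = sup_A |μ(A) - ν(A)|`, the supremum being over the measurable sets. -/
def tvDist {α : Type*} [MeasurableSpace α] (μ ν : Measure α) : ℝ :=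
  ⨆ A : {A : Set α // MeasurableSet A}, |μ.real A - ν.real A|

/-- The set `G_d^n` of `n`-tuples of vertices of the complete graph on `d` vertices, the vertices
being labelled by the residues modulo `d`; it is a group under coordinatewise addition. -/
abbrev State (d n : ℕ) : Type := Fin n → ZMod d

/-- The uniform distribution `π_d` on `G_d^n`. -/
def unif (d n : ℕ) : Measure (State d n) := uniformOn Set.univ

/-- `N` is (the counting process of) a unit-rate Poisson process on `[0, ∞)`: `N t` is the number
of incidents in `(0, t]`. It is null at time `0`, has nondecreasing right-continuous paths and
independent increments, and its increment over `(s, t]` is Poisson with mean `t - s`. -/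
structure IsUnitPoissonProcess {Ω : Type*} [MeasurableSpace Ω] (P : Measure Ω)
    (N : ℝ≥0 → Ω → ℕ) : Prop where
  measurable : ∀ t, Measurable (N t)
  zero : ∀ᵐ ω ∂P, N 0 ω = 0
  monotone : ∀ᵐ ω ∂P, Monotone fun t => N t ω
  rightContinuous : ∀ᵐ ω ∂P, ∀ t, ContinuousWithinAt (fun s => N s ω) (Set.Ici t) t
  indepIncrements : HasIndepIncrements N P
  increment_law : ∀ s t, s ≤ t →
    HasLaw (fun ω => N t ω - N s ω) (poissonMeasure (t - s)) P

/-- `(N, m)` is a unit-rate marked Poisson process on `[0, ∞)` with marks uniform on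
`{1, …, d - 1}`: `N` counts the incidents, and `m j` is the mark of the incident number `j`
(the incidents being numbered `0, 1, 2, …` in the order of time). The marks are independent,
uniform, and independent of the incident times. -/
structure IsMarkedPoissonProcess {Ω : Type*} [MeasurableSpace Ω] (P : Measure Ω) (d : ℕ)
    (N : ℝ≥0 → Ω → ℕ) (m : ℕ → Ω → ℕ) : Prop where
  poisson : IsUnitPoissonProcess P N
  mark_measurable : ∀ j, Measurable (m j)
  mark_law : ∀ j, HasLaw (m j) (uniformOn (Set.Icc 1 (d - 1))) P
  mark_indep : iIndepFun m P
  indep : IndepFun (fun ω t => N t ω) (fun ω j => m j ω) P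

/-- `Λ_i = (N i, m i)`, `i < n`, are independent unit-rate marked Poisson processes on `[0, ∞)`
with marks uniform on `{1, …, d - 1}`. -/
structure IsIndepMarkedPoissonFamily {Ω : Type*} [MeasurableSpace Ω] (P : Measure Ω) (d n : ℕ)
    (N : Fin n → ℝ≥0 → Ω → ℕ) (m : Fin n → ℕ → Ω → ℕ) : Prop where
  marked : ∀ i, IsMarkedPoissonProcess P d (N i) (m i)
  indep : iIndepFun
    (fun i ω => ((fun t => N i t ω, fun j => m i j ω) : (ℝ≥0 → ℕ) × (ℕ → ℕ))) P

/-- The simple symmetric continuous-time random walk on `G_d^n` started at `0` and driven by the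
marked Poisson processes `Λ_i = (N i, m i)`: at each incident of `Λ_i`, the `i`-th coordinate is
increased modulo `d` by the mark of that incident. -/
def walk {Ω : Type*} (d n : ℕ) (N : Fin n → ℝ≥0 → Ω → ℕ) (m : Fin n → ℕ → Ω → ℕ)
    (t : ℝ≥0) (ω : Ω) : State d n :=
  fun i => ∑ j ∈ Finset.range (N i t ω), (m i j ω : ZMod d)

/-- The distance `‖𝓛(X_t) - π_d‖_TV` from equilibrium of the walk on `G_d^n` at time `t`. Times
are real numbers; only `t ≥ 0` is meaningful (a negative `t` is read as `0`). -/
def distToEquilibrium {Ω : Type*} [MeasurableSpace Ω] (P : Measure Ω) (d n : ℕ)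
    (N : Fin n → ℝ≥0 → Ω → ℕ) (m : Fin n → ℕ → Ω → ℕ) (t : ℝ) : ℝ :=
  tvDist (P.map (walk d n N m t.toNNReal)) (unif d n)

/-- The time `T_d = ½ ((d - 1) / d) log n`. -/
def cutoffTime (d n : ℕ) : ℝ := 1 / 2 * (((d : ℝ) - 1) / d) * Real.log n

/-- The standard normal distribution function `Φ`. -/
def stdNormalCDF (x : ℝ) : ℝ := cdf (gaussianReal 0 1) x

/-- A family of distances to equilibrium `δ n t` (`n` indexing the chains, `t` the time) exhibits a
cutoff at the times `T n`: asymptotically the distance drops abruptly from its maximal value `1`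
to `0` at time `T n`, on the time scale of `T n`. -/
structure HasCutoff (δ : ℕ → ℝ → ℝ) (T : ℕ → ℝ) : Prop where
  before : ∀ c : ℝ, 0 < c → c < 1 → Tendsto (fun n => δ n (c * T n)) atTop (𝓝 1)
  after : ∀ c : ℝ, 1 < c → Tendsto (fun n => δ n (c * T n)) atTop (𝓝 0)

end CompleteGraphWalk

end

namespace CompleteGraphWalk

/-! With marks uniform on the nonzero residues, `r` jumps of one coordinate give the law `mixLaw d
(ρ ^ r)`, `ρ = -1/(d-1)`. Averaging over a Poisson number of jumps gives `mixLaw d ε` with `ε = exp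
(-d t/(d-1))`. Coordinates are independent, so the distance at time `t` is exactly `mixDist d n ε`
(`distToEquilibrium_eq_mixDist`).

This distance is the mean of `(1 - L)⁺` under the uniform law, `L` being the likelihood ratio. In
each coordinate the ratio takes two values, so `log L` is affine in the number of zero coordinates,
that is, in a sum of i.i.d. standardized scores (`mixDist_eq_integral`). For `ε = a/√n` and `s =
√(d-1) a`, Taylor expansion of the coefficients, the central limit theorem and Slutsky's lemma give
`log L → s Z - s²/2` in law, `Z` standard normal. The limit of the distance is therefore that
between `N(0,1)` and `N(s,1)`, namely `2Φ(s/2) - 1` (`tendsto_mixDist`).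

Time `T_d + θ` corresponds to `a = exp (-dθ/(d-1))`. Time `c T_d` corresponds to `n ^ ((1-c)/2)` in
place of `a`; as the distance is monotone in `ε` (`mixDist_mono`), comparison with large or small
fixed `a` yields the cutoff. -/

/-- On a finite space, the total variation distance is the sum of the positive parts of the
differences of the point masses. -/
theorem tvDist_eq_sum_max {α : Type*} [Fintype α] [MeasurableSpace α] [DiscreteMeasurableSpace α]
    (μ ν : Measure α) [IsProbabilityMeasure μ] [IsProbabilityMeasure ν] :
    tvDist μ ν = ∑ x, max 0 (ν.real {x} - μ.real {x}) := by
  classical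
  have key : ∀ A : Set α, ν.real A - μ.real A ≤ ∑ x, max 0 (ν.real {x} - μ.real {x}) := by
    intro A
    have hA : A = ((A.toFinset : Finset α) : Set α) := by simp
    rw [hA, ← sum_measureReal_singleton, ← sum_measureReal_singleton, ← Finset.sum_sub_distrib]
    exact (Finset.sum_le_sum fun x _ => le_max_right 0 _).trans
      (Finset.sum_le_sum_of_subset_of_nonneg (Finset.subset_univ _)
        fun x _ _ => le_max_left _ _)
  have hle : ∀ A : {A : Set α // MeasurableSet A},
      |μ.real A - ν.real A| ≤ ∑ x, max 0 (ν.real {x} - μ.real {x}) := by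
    rintro ⟨A, hA⟩
    rw [abs_le]
    -- Complements exchange the signs, so the one-sided bound suffices.
    have h1 := key A
    have h2 := key Aᶜ
    rw [probReal_compl_eq_one_sub hA, probReal_compl_eq_one_sub hA] at h2
    constructor <;> simp only <;> linarith
  have : Nonempty {A : Set α // MeasurableSet A} := ⟨⟨∅, MeasurableSet.empty⟩⟩
  refine le_antisymm (ciSup_le hle) ?_
  let B : Finset α := Finset.univ.filter fun x => 0 ≤ ν.real {x} - μ.real {x}
  have hB : ∑ x, max 0 (ν.real {x} - μ.real {x}) = ν.real (B : Set α) - μ.real (B : Set α) := by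
    rw [← sum_measureReal_singleton, ← sum_measureReal_singleton, ← Finset.sum_sub_distrib,
      Finset.sum_filter]
    refine Finset.sum_congr rfl fun x _ => ?_
    split_ifs with h
    · exact max_eq_right h
    · exact max_eq_left (not_le.1 h).le
  rw [hB]
  refine (le_abs_self _).trans ?_
  rw [abs_sub_comm]
  exact le_ciSup (f := fun A : {A : Set α // MeasurableSet A} => |μ.real A - ν.real A|)
    ⟨_, Set.forall_mem_range.2 hle⟩ ⟨(B : Set α), MeasurableSet.of_discrete⟩

/-! ### Mixtures of the uniform law and a point mass -/

section Mixture

/-- The mixture of the uniform law on the residues modulo `d`, with weight `1 - ε`, and of the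
point mass at `0`, with weight `ε`. -/
noncomputable def mixLaw (d : ℕ) (ε : ℝ) (x : ZMod d) : ℝ :=
  (1 - ε) / d + if x = 0 then ε else 0

/-- The distance from uniformity of the `n`-fold product of `mixLaw d ε`. -/
noncomputable def mixDist (d n : ℕ) [NeZero d] (ε : ℝ) : ℝ :=
  ∑ x : State d n, max 0 (((d : ℝ)⁻¹) ^ n - ∏ i, mixLaw d ε (x i))

variable {d : ℕ} [NeZero d]

theorem natCast_pos_of_neZero : (0 : ℝ) < d := by
  exact_mod_cast Nat.pos_of_ne_zero (NeZero.ne d)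

theorem mixLaw_nonneg {ε : ℝ} (h0 : 0 ≤ ε) (h1 : ε ≤ 1) (x : ZMod d) : 0 ≤ mixLaw d ε x := by
  have hd := natCast_pos_of_neZero (d := d)
  unfold mixLaw
  have : 0 ≤ (1 - ε) / d := div_nonneg (by linarith) hd.le
  split_ifs <;> linarith

theorem sum_mixLaw (ε : ℝ) : ∑ x : ZMod d, mixLaw d ε x = 1 := by
  have hd := natCast_pos_of_neZero (d := d)
  simp only [mixLaw, Finset.sum_add_distrib, Finset.sum_const, Finset.card_univ, ZMod.card,
    Finset.sum_ite_eq', Finset.mem_univ, if_true, nsmul_eq_mul]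
  field_simp
  ring

theorem sum_prod_mixLaw (n : ℕ) (ε : ℝ) :
    ∑ x : State d n, ∏ i, mixLaw d ε (x i) = 1 := by
  rw [← Fintype.piFinset_univ, ← Finset.prod_univ_sum]
  simp [sum_mixLaw]

/-- The uniform part absorbs any convolution and the point mass at `0` is neutral, so convolving
multiplies the parameters. -/
theorem mixLaw_mul (ε η : ℝ) (x : ZMod d) :
    mixLaw d (ε * η) x = ∑ y, mixLaw d η y * mixLaw d ε (x - y) := by
  have hd := natCast_pos_of_neZero (d := d)
  have h : ∑ y, mixLaw d ε (x - y) = 1 :=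
    (Equiv.sum_comp (Equiv.subLeft x) (mixLaw d ε)).trans (sum_mixLaw ε)
  simp only [mixLaw.eq_1 d η, add_mul, Finset.sum_add_distrib, ite_mul, zero_mul,
    Finset.sum_ite_eq', Finset.mem_univ, if_true, sub_zero, ← Finset.mul_sum, h]
  simp only [mixLaw]
  split_ifs <;> field_simp <;> ring

theorem prod_mixLaw_mul {n : ℕ} (ε η : ℝ) (x : State d n) :
    ∏ i, mixLaw d (ε * η) (x i)
      = ∑ y : State d n, (∏ i, mixLaw d η (y i)) * ∏ i, mixLaw d ε ((x - y) i) := by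
  simp_rw [mixLaw_mul]
  rw [Finset.prod_univ_sum, Fintype.piFinset_univ]
  simp [Finset.prod_mul_distrib]

/-- The distance from uniformity decreases along the semigroup. -/
theorem mixDist_mul_le (n : ℕ) {ε η : ℝ} (h0 : 0 ≤ η) (h1 : η ≤ 1) :
    mixDist d n (ε * η) ≤ mixDist d n ε := by
  have hpos : ∀ y : State d n, 0 ≤ ∏ i, mixLaw d η (y i) :=
    fun y => Finset.prod_nonneg fun i _ => mixLaw_nonneg h0 h1 _
  calc mixDist d n (ε * η)
      ≤ ∑ x : State d n, ∑ y : State d n, (∏ i, mixLaw d η (y i)) *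
          max 0 (((d : ℝ)⁻¹) ^ n - ∏ i, mixLaw d ε ((x - y) i)) := by
        refine Finset.sum_le_sum fun x _ => max_le ?_ ?_
        · exact Finset.sum_nonneg fun y _ => mul_nonneg (hpos y) (le_max_left _ _)
        · rw [prod_mixLaw_mul]
          -- The constant is spread over the `η`-weights, which sum to `1`, so that the positive
          -- part can be taken inside the average.
          nth_rewrite 1 [← one_mul (((d : ℝ)⁻¹) ^ n)]
          rw [← sum_prod_mixLaw (d := d) n η, Finset.sum_mul, ← Finset.sum_sub_distrib]
          refine Finset.sum_le_sum fun y _ => ?_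
          rw [← mul_sub]
          exact mul_le_mul_of_nonneg_left (le_max_right _ _) (hpos y)
    _ = ∑ y : State d n, (∏ i, mixLaw d η (y i)) * mixDist d n ε := by
        rw [Finset.sum_comm]
        refine Finset.sum_congr rfl fun y _ => ?_
        rw [← Finset.mul_sum]
        congr 1
        exact Equiv.sum_comp (Equiv.subRight y)
          fun z : State d n => max 0 (((d : ℝ)⁻¹) ^ n - ∏ i, mixLaw d ε (z i))
    _ = mixDist d n ε := by rw [← Finset.sum_mul, sum_prod_mixLaw, one_mul]

theorem mixDist_mono (n : ℕ) {ε η : ℝ} (h0 : 0 ≤ ε) (h : ε ≤ η) :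
    mixDist d n ε ≤ mixDist d n η := by
  rcases (h0.trans h).eq_or_lt with hη | hη
  · rw [le_antisymm h (hη ▸ h0)]
  · have := mixDist_mul_le (d := d) n (ε := η) (div_nonneg h0 hη.le) (div_le_one_of_le₀ h hη.le)
    rwa [mul_div_cancel₀ _ hη.ne'] at this

theorem mixDist_nonneg (n : ℕ) (ε : ℝ) : 0 ≤ mixDist d n ε :=
  Finset.sum_nonneg fun _ _ => le_max_left _ _

theorem mixDist_le_one (n : ℕ) {ε : ℝ} (h0 : 0 ≤ ε) (h1 : ε ≤ 1) : mixDist d n ε ≤ 1 := by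
  have hd := natCast_pos_of_neZero (d := d)
  calc mixDist d n ε ≤ ∑ _x : State d n, ((d : ℝ)⁻¹) ^ n := by
        refine Finset.sum_le_sum fun x _ => max_le (by positivity) ?_
        exact sub_le_self _ (Finset.prod_nonneg fun i _ => mixLaw_nonneg h0 h1 _)
    _ = 1 := by
        simp [hd.ne']

end Mixture

theorem unif_real_singleton {d : ℕ} [NeZero d] (n : ℕ) (x : State d n) :
    (unif d n).real {x} = ((d : ℝ)⁻¹) ^ n := by
  rw [measureReal_def, unif, uniformOn_univ]
  simp

instance isProbabilityMeasure_unif {d : ℕ} [NeZero d] (n : ℕ) :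
    IsProbabilityMeasure (unif d n) :=
  isProbabilityMeasure_uniformOn Set.finite_univ Set.univ_nonempty

/-! ### The law of one coordinate -/

section OneCoordinate

variable {d : ℕ} [NeZero d] {Ω : Type*} [MeasurableSpace Ω] {P : Measure Ω}

theorem measureReal_mark_cast (hd : 2 ≤ d) {m : Ω → ℕ}
    (hlaw : HasLaw m (uniformOn (Set.Icc 1 (d - 1))) P) (y : ZMod d) :
    P.real {ω | (m ω : ZMod d) = y} = if y = 0 then 0 else ((d : ℝ) - 1)⁻¹ := by
  classical
  rw [hlaw.measureReal_eq (p := fun k => (k : ZMod d) = y) MeasurableSet.of_discrete,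
    measureReal_def, uniformOn, cond_apply MeasurableSet.of_discrete]
  have hc : (Set.Icc 1 (d - 1) : Set ℕ) = ((Finset.Icc 1 (d - 1) : Finset ℕ) : Set ℕ) := by simp
  have hs : (Set.Icc 1 (d - 1) : Set ℕ) ∩ {k | (k : ZMod d) = y}
      = (((if y = 0 then ∅ else {y.val}) : Finset ℕ) : Set ℕ) := by
    ext k
    simp only [Set.mem_inter_iff, Set.mem_Icc, Set.mem_ofPred_eq, Finset.mem_coe]
    constructor
    · rintro ⟨⟨h1, h2⟩, rfl⟩
      have hk : ((k : ZMod d)).val = k := ZMod.val_cast_of_lt (by omega)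
      have h0 : (k : ZMod d) ≠ 0 := by
        intro h
        rw [h, ZMod.val_zero] at hk
        omega
      simp [h0, hk]
    · intro hk
      split_ifs at hk with h0
      · simp at hk
      · rw [Finset.mem_singleton] at hk
        subst hk
        have h1 := ZMod.val_lt y
        have h2 : y.val ≠ 0 := by rwa [Ne, ZMod.val_eq_zero]
        exact ⟨⟨by omega, by omega⟩, by simp⟩
  rw [hs, hc, Measure.count_apply_finset, Measure.count_apply_finset]
  split_ifs with h0
  · simp
  · have h1 : (1 : ENNReal) ≤ d := by exact_mod_cast (show 1 ≤ d by omega)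
    simp [ENNReal.toReal_sub_of_le h1 (ENNReal.natCast_ne_top d)]

/-- A single mark has law `mixLaw d (-1/(d-1))`, a negative parameter, and independent sums multiply
parameters. -/
theorem measureReal_sum_marks [IsProbabilityMeasure P] (hd : 2 ≤ d) {m : ℕ → Ω → ℕ}
    (hm : ∀ j, Measurable (m j))
    (hlaw : ∀ j, HasLaw (m j) (uniformOn (Set.Icc 1 (d - 1))) P) (hind : iIndepFun m P)
    (r : ℕ) (k : ZMod d) :
    P.real {ω | ∑ j ∈ Finset.range r, (m j ω : ZMod d) = k} =
      mixLaw d ((-((d : ℝ) - 1)⁻¹) ^ r) k := by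
  have hd' : (2 : ℝ) ≤ d := by exact_mod_cast hd
  have hc : ∀ j, Measurable fun ω => (m j ω : ZMod d) :=
    fun j => Measurable.of_discrete.comp (hm j)
  induction r generalizing k with
  | zero =>
    by_cases hk : k = 0
    · simp [mixLaw, hk]
    · simp [mixLaw, hk, Ne.symm hk]
  | succ r ih =>
    have hS : Measurable fun ω => ∑ j ∈ Finset.range r, (m j ω : ZMod d) :=
      Finset.measurable_sum _ fun j _ => hc j
    have hI : IndepFun (fun ω => ∑ j ∈ Finset.range r, (m j ω : ZMod d))
        (fun ω => (m r ω : ZMod d)) P := by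
      have h := (hind.comp (fun _ (k : ℕ) => (k : ZMod d))
        fun _ => Measurable.of_discrete).indepFun_sum_range_succ hc r
      convert! h using 1
      ext ω
      simp
    have hsplit : {ω | ∑ j ∈ Finset.range (r + 1), (m j ω : ZMod d) = k} =
        ⋃ y ∈ (Finset.univ : Finset (ZMod d)),
          ((fun ω => ∑ j ∈ Finset.range r, (m j ω : ZMod d)) ⁻¹' {k - y} ∩
            (fun ω => (m r ω : ZMod d)) ⁻¹' {y}) := by
      ext ω
      simp [Finset.sum_range_succ, eq_sub_iff_add_eq]
    rw [hsplit, measureReal_biUnion_finset]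
    · have hterm : ∀ y : ZMod d,
          P.real ((fun ω => ∑ j ∈ Finset.range r, (m j ω : ZMod d)) ⁻¹' {k - y} ∩
            (fun ω => (m r ω : ZMod d)) ⁻¹' {y}) =
          mixLaw d ((-((d : ℝ) - 1)⁻¹) ^ r) (k - y) * if y = 0 then 0 else ((d : ℝ) - 1)⁻¹ := by
        intro y
        rw [measureReal_def, hI.measure_inter_preimage_eq_mul _ _ (measurableSet_singleton _)
          (measurableSet_singleton _), ENNReal.toReal_mul, ← ih (k - y),
          ← measureReal_mark_cast hd (hlaw r) y]
        rfl
      simp_rw [hterm]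
      have h1 : ∑ y, mixLaw d ((-((d : ℝ) - 1)⁻¹) ^ r) (k - y) = 1 :=
        (Equiv.sum_comp (Equiv.subLeft k) (mixLaw d _)).trans (sum_mixLaw _)
      -- The sum over `y ≠ 0` is the full sum, equal to `1` by `h1`, less the term `y = 0`.
      have h2 : ∀ y : ZMod d,
          (mixLaw d ((-((d : ℝ) - 1)⁻¹) ^ r) (k - y) * if y = 0 then 0 else ((d : ℝ) - 1)⁻¹) =
          mixLaw d ((-((d : ℝ) - 1)⁻¹) ^ r) (k - y) * ((d : ℝ) - 1)⁻¹ -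
            if y = 0 then mixLaw d ((-((d : ℝ) - 1)⁻¹) ^ r) k * ((d : ℝ) - 1)⁻¹ else 0 := by
        intro y
        by_cases h : y = 0 <;> simp [h]
      simp_rw [h2]
      rw [Finset.sum_sub_distrib, ← Finset.sum_mul, h1, Finset.sum_ite_eq',
        if_pos (Finset.mem_univ _), pow_succ]
      have hne : (d : ℝ) - 1 ≠ 0 := by linarith
      have hne' : (d : ℝ) ≠ 0 := by linarith
      simp only [mixLaw]
      generalize (-((d : ℝ) - 1)⁻¹) ^ r = ρ
      split_ifs <;> field_simp <;> ring
    · intro y _ z _ hyz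
      refine Set.disjoint_left.2 fun ω h1 h2 => hyz ?_
      exact h1.2.symm.trans h2.2
    · intro y _
      exact (hS (measurableSet_singleton _)).inter (hc r (measurableSet_singleton _))

/-- The sum of the first `f t` terms of `g`, as a function of the pair `(f, g)`. -/
theorem measurable_markSum (t : ℝ≥0) :
    Measurable fun p : (ℝ≥0 → ℕ) × (ℕ → ℕ) =>
      ∑ j ∈ Finset.range (p.1 t), (p.2 j : ZMod d) := by
  have h : Measurable fun q : (ℕ → ℕ) × ℕ => ∑ j ∈ Finset.range q.2, (q.1 j : ZMod d) :=
    measurable_from_prod_countable_left fun r =>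
      Finset.measurable_sum (Finset.range r) fun j _ =>
        (Measurable.of_discrete (f := fun k : ℕ => (k : ZMod d))).comp (measurable_pi_apply j)
  exact h.comp (measurable_snd.prodMk ((measurable_pi_apply t).comp measurable_fst))

-- `mixLaw` is affine in its parameter, so only the Poisson generating function `exp (t (ρ - 1))` is
-- needed, and `ρ - 1 = -d/(d-1)`.
omit [NeZero d] in
theorem hasSum_poisson_mixLaw (hd : 2 ≤ d) (t : ℝ≥0) (k : ZMod d) :
    HasSum (fun r : ℕ => Real.exp (-t) * t ^ r / r.factorial *
      mixLaw d ((-((d : ℝ) - 1)⁻¹) ^ r) k)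
      (mixLaw d (Real.exp (-(d * t / ((d : ℝ) - 1)))) k) := by
  have hd' : (2 : ℝ) ≤ d := by exact_mod_cast hd
  have hne : (d : ℝ) - 1 ≠ 0 := by linarith
  set ρ : ℝ := -((d : ℝ) - 1)⁻¹ with hρ
  have hexp : ∀ x : ℝ, HasSum (fun r : ℕ => x ^ r / r.factorial) (Real.exp x) := by
    intro x
    rw [Real.exp_eq_exp_ℝ]
    exact NormedSpace.expSeries_div_hasSum_exp x
  have h1 := ((hexp t).mul_left (Real.exp (-t)))
  have h2 := ((hexp (t * ρ)).mul_left (Real.exp (-t)))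
  rw [← Real.exp_add, neg_add_cancel, Real.exp_zero] at h1
  rw [← Real.exp_add] at h2
  have he : -(t : ℝ) + t * ρ = -(d * t / ((d : ℝ) - 1)) := by
    rw [hρ]; field_simp; ring
  rw [he] at h2
  have h3 := (h1.mul_right (1 / (d : ℝ))).add
    (h2.mul_right ((if k = 0 then 1 else 0) - 1 / (d : ℝ)))
  have hval : mixLaw d (Real.exp (-(d * t / ((d : ℝ) - 1)))) k = 1 * (1 / (d : ℝ)) +
      Real.exp (-(d * t / ((d : ℝ) - 1))) * ((if k = 0 then 1 else 0) - 1 / (d : ℝ)) := by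
    simp only [mixLaw]
    split_ifs <;> ring
  rw [hval]
  refine Eq.subst (motive := fun f => HasSum f _) (funext fun r => ?_) h3
  simp only [mixLaw, mul_pow]
  split_ifs <;> ring

theorem measureReal_coordinate [IsProbabilityMeasure P] (hd : 2 ≤ d)
    {N : ℝ≥0 → Ω → ℕ} {m : ℕ → Ω → ℕ} (h : IsMarkedPoissonProcess P d N m) (t : ℝ≥0)
    (k : ZMod d) :
    P.real {ω | ∑ j ∈ Finset.range (N t ω), (m j ω : ZMod d) = k} =
      mixLaw d (Real.exp (-(d * t / ((d : ℝ) - 1)))) k := by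
  have hN : ∀ r : ℕ, P.real (N t ⁻¹' {r}) = Real.exp (-t) * t ^ r / r.factorial := by
    intro r
    have hl : HasLaw (N t) (poissonMeasure t) P := by
      have h1 := h.poisson.increment_law 0 t zero_le
      rw [tsub_zero] at h1
      refine h1.congr ?_
      filter_upwards [h.poisson.zero] with ω hω
      simp [hω]
    rw [← poissonMeasure_real_singleton]
    exact hl.measureReal_eq (p := fun k => k = r) (measurableSet_singleton r)
  have hS : ∀ r : ℕ, Measurable fun ω => ∑ j ∈ Finset.range r, (m j ω : ZMod d) :=
    fun r => Finset.measurable_sum _ fun j _ => Measurable.of_discrete.comp (h.mark_measurable j)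
  have hI : ∀ r : ℕ, IndepFun (N t) (fun ω => ∑ j ∈ Finset.range r, (m j ω : ZMod d)) P := by
    intro r
    exact h.indep.comp (φ := fun f : ℝ≥0 → ℕ => f t)
      (ψ := fun g : ℕ → ℕ => ∑ j ∈ Finset.range r, (g j : ZMod d)) (measurable_pi_apply t)
      (Finset.measurable_sum _ fun j _ => Measurable.of_discrete.comp (measurable_pi_apply j))
  have hsplit : {ω | ∑ j ∈ Finset.range (N t ω), (m j ω : ZMod d) = k} =
      ⋃ r : ℕ, (N t ⁻¹' {r} ∩ (fun ω => ∑ j ∈ Finset.range r, (m j ω : ZMod d)) ⁻¹' {k}) := by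
    ext ω
    simp
  rw [measureReal_def, hsplit, measure_iUnion, ENNReal.tsum_toReal_eq fun _ => measure_ne_top _ _]
  · rw [← (hasSum_poisson_mixLaw hd t k).tsum_eq]
    refine tsum_congr fun r => ?_
    rw [(hI r).measure_inter_preimage_eq_mul _ _ (measurableSet_singleton _)
      (measurableSet_singleton _), ENNReal.toReal_mul, ← hN r,
      ← measureReal_sum_marks hd h.mark_measurable h.mark_law h.mark_indep r k]
    rfl
  · intro r s hrs
    exact Set.disjoint_left.2 fun ω h1 h2 => hrs (h1.1.symm.trans h2.1)
  · intro r
    exact (h.poisson.measurable t (measurableSet_singleton _)).inter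
      (hS r (measurableSet_singleton _))

end OneCoordinate

/-! ### From the walk to the product of mixtures -/

section Walk

variable {d n : ℕ} [NeZero d] {Ω : Type*} [MeasurableSpace Ω] {P : Measure Ω}
  {N : Fin n → ℝ≥0 → Ω → ℕ} {m : Fin n → ℕ → Ω → ℕ}

theorem measurable_walk (h : IsIndepMarkedPoissonFamily P d n N m) (t : ℝ≥0) :
    Measurable (walk d n N m t) := by
  refine measurable_pi_lambda _ fun i => ?_
  exact (measurable_markSum (d := d) t).comp
    ((measurable_pi_lambda _ fun s => (h.marked i).poisson.measurable s).prodMk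
      (measurable_pi_lambda _ fun j => (h.marked i).mark_measurable j))

theorem map_walk_real_singleton [IsProbabilityMeasure P] (hd : 2 ≤ d) (h : IsIndepMarkedPoissonFamily P d n N m)
    (t : ℝ≥0) (x : State d n) :
    (P.map (walk d n N m t)).real {x} =
      ∏ i, mixLaw d (Real.exp (-(d * t / ((d : ℝ) - 1)))) (x i) := by
  rw [map_measureReal_apply (measurable_walk h t) (measurableSet_singleton x)]
  have hI := h.indep.comp (fun _ (p : (ℝ≥0 → ℕ) × (ℕ → ℕ)) =>
    ∑ j ∈ Finset.range (p.1 t), (p.2 j : ZMod d)) fun _ => measurable_markSum t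
  have hset : walk d n N m t ⁻¹' {x} = ⋂ i ∈ (Finset.univ : Finset (Fin n)),
      ((fun p : (ℝ≥0 → ℕ) × (ℕ → ℕ) => ∑ j ∈ Finset.range (p.1 t), (p.2 j : ZMod d)) ∘
        fun ω => (fun t => N i t ω, fun j => m i j ω)) ⁻¹' {x i} := by
    ext ω
    simp [walk, funext_iff]
  rw [hset, measureReal_def, hI.measure_inter_preimage_eq_mul _
    fun _ _ => measurableSet_singleton _, ENNReal.toReal_prod]
  exact Finset.prod_congr rfl fun i _ => measureReal_coordinate hd (h.marked i) t (x i)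

theorem distToEquilibrium_eq_mixDist [IsProbabilityMeasure P] (hd : 2 ≤ d) (h : IsIndepMarkedPoissonFamily P d n N m)
    {t : ℝ} (ht : 0 ≤ t) :
    distToEquilibrium P d n N m t = mixDist d n (Real.exp (-(d * t / ((d : ℝ) - 1)))) := by
  have : IsProbabilityMeasure (P.map (walk d n N m t.toNNReal)) :=
    Measure.isProbabilityMeasure_map (measurable_walk h _).aemeasurable
  rw [distToEquilibrium, tvDist_eq_sum_max]
  simp_rw [map_walk_real_singleton hd h, unif_real_singleton, Real.coe_toNNReal t ht]
  rfl

end Walk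

/-! ### The Gaussian limit functional -/

open scoped BoundedContinuousFunction

/-- The bounded continuous function `y ↦ (1 - e ^ y)⁺`. -/
noncomputable def expDefect : ℝ →ᵇ ℝ :=
  BoundedContinuousFunction.ofNormedAddCommGroup (fun y => max 0 (1 - Real.exp y))
    (by fun_prop) 1 fun y => by
      rw [Real.norm_of_nonneg (le_max_left _ _)]
      exact max_le zero_le_one (by linarith [Real.exp_pos y])

theorem expDefect_apply (y : ℝ) : expDefect y = max 0 (1 - Real.exp y) := rfl

theorem norm_expDefect_le (y : ℝ) : ‖expDefect y‖ ≤ 1 := by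
  rw [expDefect_apply, Real.norm_of_nonneg (le_max_left _ _)]
  exact max_le zero_le_one (by linarith [Real.exp_pos y])

section Gaussian

theorem stdNormalCDF_neg (x : ℝ) : stdNormalCDF (-x) = 1 - stdNormalCDF x := by
  have : NullSingletonClass (gaussianReal 0 1) := nullSingletonClass_gaussianReal one_ne_zero
  rw [stdNormalCDF, stdNormalCDF, cdf_eq_real, cdf_eq_real,
    ← probReal_compl_eq_one_sub measurableSet_Iic, Set.compl_Iic]
  have h : (gaussianReal 0 1).map (fun x => -x) = gaussianReal 0 1 := by
    rw [gaussianReal_map_neg, neg_zero]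
  nth_rewrite 1 [← h]
  rw [map_measureReal_apply measurable_neg measurableSet_Iic, measureReal_def, measureReal_def,
    Set.neg_preimage, Set.neg_Iic, neg_neg, measure_congr Ioi_ae_eq_Ici]

theorem gaussianPDFReal_mul_exp (s y : ℝ) :
    gaussianPDFReal 0 1 y * Real.exp (s * y - s ^ 2 / 2) = gaussianPDFReal s 1 y := by
  simp only [gaussianPDFReal, mul_assoc, ← Real.exp_add]
  congr 2
  simp only [NNReal.coe_one]
  ring

/-- By `gaussianPDFReal_mul_exp` the exponential is the likelihood ratio of `N(s,1)` to `N(0,1)`;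
the two densities cross at `s/2`. -/
theorem integral_expDefect_gaussian {s : ℝ} (hs : 0 ≤ s) :
    ∫ y, expDefect (s * y - s ^ 2 / 2) ∂gaussianReal 0 1 = 2 * stdNormalCDF (s / 2) - 1 := by
  have hpt : ∀ y, gaussianPDFReal 0 1 y • expDefect (s * y - s ^ 2 / 2) =
      (Set.Iic (s / 2)).indicator (fun y => gaussianPDFReal 0 1 y - gaussianPDFReal s 1 y) y := by
    intro y
    rw [expDefect_apply, smul_eq_mul, Set.indicator_apply]
    split_ifs with h
    · rw [Set.mem_Iic] at h
      rw [max_eq_right, mul_sub, mul_one, gaussianPDFReal_mul_exp]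
      rw [sub_nonneg, Real.exp_le_one_iff]
      nlinarith
    · rw [Set.mem_Iic, not_le] at h
      rw [max_eq_left, mul_zero]
      rw [sub_nonpos, Real.one_le_exp_iff]
      nlinarith
  have hcdf : ∀ m : ℝ, ∫ y in Set.Iic (s / 2), gaussianPDFReal m 1 y =
      (gaussianReal m 1).real (Set.Iic (s / 2)) := by
    intro m
    rw [measureReal_def, gaussianReal_apply_eq_integral m one_ne_zero, ENNReal.toReal_ofReal]
    exact integral_nonneg fun y => gaussianPDFReal_nonneg _ _ _
  have hshift : (gaussianReal s 1).real (Set.Iic (s / 2)) = stdNormalCDF (-(s / 2)) := by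
    rw [stdNormalCDF, cdf_eq_real]
    have h := gaussianReal_map_add_const (μ := 0) (v := 1) s
    rw [zero_add] at h
    rw [← h, map_measureReal_apply (measurable_add_const s) measurableSet_Iic]
    congr 1
    ext y
    simp only [Set.mem_preimage, Set.mem_Iic]
    constructor <;> intro <;> linarith
  rw [integral_gaussianReal_eq_integral_smul one_ne_zero]
  simp_rw [hpt]
  rw [integral_indicator measurableSet_Iic, integral_sub
    (integrable_gaussianPDFReal _ _).integrableOn (integrable_gaussianPDFReal _ _).integrableOn,
    hcdf, hcdf, hshift, stdNormalCDF_neg, ← cdf_eq_real, ← stdNormalCDF]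
  ring

theorem tendsto_two_mul_stdNormalCDF_zero :
    Tendsto (fun s : ℝ => 2 * stdNormalCDF (s / 2) - 1) (𝓝[≥] 0) (𝓝 0) := by
  have h : Tendsto (fun s : ℝ => ∫ y, expDefect (s * y - s ^ 2 / 2) ∂gaussianReal 0 1) (𝓝 0)
      (𝓝 (∫ y, expDefect (0 * y - 0 ^ 2 / 2) ∂gaussianReal 0 1)) := by
    refine tendsto_integral_filter_of_dominated_convergence (fun _ => 1)
      (Eventually.of_forall fun s => ?_) (Eventually.of_forall fun s => ?_)
      (integrable_const 1) ?_
    · exact (by fun_prop : Continuous fun y : ℝ =>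
        expDefect (s * y - s ^ 2 / 2)).aestronglyMeasurable
    · exact Eventually.of_forall fun y => norm_expDefect_le _
    · refine Eventually.of_forall fun y => ?_
      exact (by fun_prop : Continuous fun s : ℝ => expDefect (s * y - s ^ 2 / 2)).tendsto 0
  have h0 : ∫ y, expDefect (0 * y - 0 ^ 2 / 2) ∂gaussianReal 0 1 = 0 := by
    simp [expDefect_apply]
  rw [h0] at h
  refine (h.mono_left nhdsWithin_le_nhds).congr' ?_
  filter_upwards [self_mem_nhdsWithin] with s hs
  exact integral_expDefect_gaussian hs

theorem tendsto_two_mul_stdNormalCDF_atTop :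
    Tendsto (fun s : ℝ => 2 * stdNormalCDF (s / 2) - 1) atTop (𝓝 1) := by
  have h := ((tendsto_cdf_atTop (gaussianReal 0 1)).comp
    (tendsto_id.atTop_div_const (show (0 : ℝ) < 2 by norm_num))).const_mul 2 |>.sub_const 1
  norm_num at h
  exact h

end Gaussian

/-! ### Logarithmic asymptotics -/

section Log

theorem tendsto_sqrt_natCast_atTop : Tendsto (fun n : ℕ => √(n : ℝ)) atTop atTop :=
  Real.tendsto_sqrt_atTop.comp tendsto_natCast_atTop_atTop

theorem tendsto_sqrt_mul_log (c : ℝ) :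
    Tendsto (fun n : ℕ => √(n : ℝ) * Real.log (1 + c / √(n : ℝ))) atTop (𝓝 c) :=
  (Real.tendsto_mul_log_one_add_div_atTop c).comp tendsto_sqrt_natCast_atTop

/-- Second-order Taylor expansion at `x = c/√n`: the remainder is at most `|x|³/(1-|x|)`, and `n`
times this is of order `1/√n`. -/
theorem tendsto_natCast_mul_log_sub (c : ℝ) :
    Tendsto (fun n : ℕ => n * Real.log (1 + c / √(n : ℝ)) - c * √(n : ℝ)) atTop
      (𝓝 (-(c ^ 2 / 2))) := by
  have hy : Tendsto (fun n : ℕ => (√(n : ℝ))⁻¹) atTop (𝓝 0) :=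
    tendsto_inv_atTop_zero.comp tendsto_sqrt_natCast_atTop
  have hcy : Tendsto (fun n : ℕ => |c| * (√(n : ℝ))⁻¹) atTop (𝓝 0) := by
    simpa using hy.const_mul |c|
  have hbound : Tendsto (fun n : ℕ => |c| ^ 3 * (√(n : ℝ))⁻¹ / (1 - |c| * (√(n : ℝ))⁻¹)) atTop
      (𝓝 0) := by
    have := (hy.const_mul (|c| ^ 3)).div (hcy.const_sub 1) (by norm_num)
    simpa [Pi.div_def] using this
  rw [← tendsto_sub_nhds_zero_iff]
  refine squeeze_zero_norm' ?_ hbound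
  filter_upwards [hcy.eventually_lt_const zero_lt_one, eventually_gt_atTop 0] with n hn hn0
  have hs : 0 < √(n : ℝ) := Real.sqrt_pos.2 (by exact_mod_cast hn0)
  have hsq : (n : ℝ) = √(n : ℝ) ^ 2 := (Real.sq_sqrt (Nat.cast_nonneg n)).symm
  have habs : |-(c / √(n : ℝ))| = |c| * (√(n : ℝ))⁻¹ := by
    rw [abs_neg, abs_div, abs_of_pos hs, div_eq_mul_inv]
  have h := Real.abs_log_sub_add_sum_range_le (x := -(c / √(n : ℝ))) (by rwa [habs]) 2
  rw [habs] at h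
  have h2 := mul_le_mul_of_nonneg_left h (Nat.cast_nonneg (α := ℝ) n)
  rw [← abs_of_nonneg (Nat.cast_nonneg (α := ℝ) n), ← abs_mul,
    abs_of_nonneg (Nat.cast_nonneg (α := ℝ) n)] at h2
  simp only [Finset.sum_range_succ, Finset.sum_range_zero, sub_neg_eq_add] at h2
  rw [Real.norm_eq_abs]
  calc _ = _ := by
        congr 1
        generalize Real.log (1 + c / √(n : ℝ)) = l
        generalize √(n : ℝ) = s at hs hsq
        have hs' : s ≠ 0 := hs.ne'
        rw [hsq]
        push_cast
        field_simp
        ring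
    _ ≤ _ := h2
    _ = _ := by
        have h1 : 1 - |c| * (√(n : ℝ))⁻¹ ≠ 0 := by linarith
        generalize √(n : ℝ) = s at hs hsq h1
        have hs' : s * s⁻¹ = 1 := mul_inv_cancel₀ hs.ne'
        rw [hsq, mul_div_assoc']
        congr 1
        linear_combination (|c| ^ 3 * s⁻¹ * (s * s⁻¹ + 1)) * hs'

end Log

/-! ### Central limit theorem for the log-likelihood ratio -/

section CLT

variable {d : ℕ} [NeZero d]

/-- The sequence of independent uniform residues modulo `d`. -/
noncomputable def unifSeq (d : ℕ) : Measure (ℕ → ZMod d) :=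
  Measure.infinitePi fun _ => uniformOn Set.univ

/-- The standardized indicator of the residue `0`. -/
noncomputable def score (d : ℕ) (x : ZMod d) : ℝ :=
  ((if x = 0 then (d : ℝ) else 0) - 1) / √((d : ℝ) - 1)

instance isProbabilityMeasure_uniformOn_zmod :
    IsProbabilityMeasure (uniformOn (Set.univ : Set (ZMod d))) :=
  isProbabilityMeasure_uniformOn Set.finite_univ Set.univ_nonempty

instance isProbabilityMeasure_unifSeq : IsProbabilityMeasure (unifSeq d) := by
  unfold unifSeq
  infer_instance

theorem integral_uniformOn_zmod (f : ZMod d → ℝ) :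
    ∫ x, f x ∂(uniformOn Set.univ) = (d : ℝ)⁻¹ * ∑ x, f x := by
  rw [integral_fintype .of_finite, Finset.mul_sum]
  refine Finset.sum_congr rfl fun x _ => ?_
  rw [measureReal_def, uniformOn_univ]
  simp

theorem integral_score : ∫ x, score d x ∂(uniformOn Set.univ) = 0 := by
  rw [integral_uniformOn_zmod]
  simp [score, ← Finset.sum_div, Finset.sum_sub_distrib, ZMod.card]

theorem integral_score_sq (hd : 2 ≤ d) : ∫ x, score d x ^ 2 ∂(uniformOn Set.univ) = 1 := by
  have hd' : (2 : ℝ) ≤ d := by exact_mod_cast hd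
  have hpos : 0 < (d : ℝ) - 1 := by linarith
  rw [integral_uniformOn_zmod]
  have h : ∀ x : ZMod d, score d x ^ 2 =
      (if x = 0 then (d : ℝ) * (d - 2) / (d - 1) else 0) + 1 / ((d : ℝ) - 1) := by
    intro x
    rw [score, div_pow, Real.sq_sqrt hpos.le]
    split_ifs <;> field_simp <;> ring
  simp_rw [h]
  rw [Finset.sum_add_distrib, Finset.sum_ite_eq', if_pos (Finset.mem_univ _)]
  simp only [Finset.sum_const, Finset.card_univ, ZMod.card, nsmul_eq_mul]
  have : (d : ℝ) ≠ 0 := by linarith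
  field_simp
  ring

theorem tendstoInDistribution_score (hd : 2 ≤ d) :
    TendstoInDistribution
      (fun (n : ℕ) (ω : ℕ → ZMod d) => (√(n : ℝ))⁻¹ * ∑ k ∈ Finset.range n, score d (ω k))
      atTop (id : ℝ → ℝ) (fun _ => unifSeq d) (gaussianReal 0 1) := by
  have hm : ∀ k : ℕ, (unifSeq d).map (fun ω => ω k) = uniformOn Set.univ :=
    fun k => Measure.infinitePi_map_eval _ k
  have hs : Measurable (score d) := Measurable.of_discrete
  have hX : ∀ k : ℕ, Measurable fun ω : ℕ → ZMod d => score d (ω k) :=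
    fun k => hs.comp (measurable_pi_apply k)
  have hint : ∀ f : ZMod d → ℝ, ∫ ω, f (ω 0) ∂(unifSeq d) = ∫ x, f x ∂(uniformOn Set.univ) := by
    intro f
    rw [← hm 0, integral_map (measurable_pi_apply 0).aemeasurable
      (Measurable.of_discrete (f := f)).aestronglyMeasurable]
  refine tendstoInDistribution_inv_sqrt_mul_sum (X := fun k (ω : ℕ → ZMod d) => score d (ω k))
    HasLaw.id ?_ ?_ ?_ ?_
  · rw [hint (score d), integral_score]
  · simp only [Pi.pow_apply]
    rw [hint fun x => score d x ^ 2, integral_score_sq hd]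
  · exact iIndepFun_infinitePi fun _ => hs
  · intro k
    refine ⟨(hX k).aemeasurable, (hX 0).aemeasurable, ?_⟩
    change Measure.map (score d ∘ fun ω : ℕ → ZMod d => ω k) _ =
      Measure.map (score d ∘ fun ω : ℕ → ZMod d => ω 0) _
    rw [← Measure.map_map hs (measurable_pi_apply k), ← Measure.map_map hs (measurable_pi_apply 0),
      hm, hm]

/-- The coefficient of the score in the logarithm of the density of `mixLaw`. -/
noncomputable def logSlope (d : ℕ) (ε : ℝ) : ℝ :=
  √((d : ℝ) - 1) / d * (Real.log (1 + (d - 1) * ε) - Real.log (1 - ε))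

/-- The mean of the logarithm of the density of `mixLaw` under the uniform law. -/
noncomputable def logMean (d : ℕ) (ε : ℝ) : ℝ :=
  (1 - 1 / (d : ℝ)) * Real.log (1 - ε) + 1 / (d : ℝ) * Real.log (1 + (d - 1) * ε)

omit [NeZero d] in
theorem mixLaw_eq_exp (hd : 2 ≤ d) {ε : ℝ} (h0 : 0 ≤ ε) (h1 : ε < 1) (x : ZMod d) :
    mixLaw d ε x = (d : ℝ)⁻¹ * Real.exp (logSlope d ε * score d x + logMean d ε) := by
  have hd' : (2 : ℝ) ≤ d := by exact_mod_cast hd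
  have hdpos : (0 : ℝ) < d := by linarith
  have hpos : 0 < √((d : ℝ) - 1) := Real.sqrt_pos.2 (by linarith)
  have hsq : √((d : ℝ) - 1) * (√((d : ℝ) - 1))⁻¹ = 1 := mul_inv_cancel₀ hpos.ne'
  have e : logSlope d ε * score d x + logMean d ε =
      if x = 0 then Real.log (1 + (d - 1) * ε) else Real.log (1 - ε) := by
    simp only [logSlope, score, logMean]
    split_ifs <;> field_simp <;> ring
  rw [e, mixLaw]
  split_ifs
  · rw [Real.exp_log (by nlinarith)]
    field_simp
    ring
  · rw [Real.exp_log (by linarith)]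
    field_simp
    ring

/-- Putting all `n` on the one space of infinite sequences lets the central limit theorem apply; the
factors `√n` cancel and only prepare for it. -/
theorem mixDist_eq_integral (hd : 2 ≤ d) {n : ℕ} (hn : 0 < n) {ε : ℝ} (h0 : 0 ≤ ε) (h1 : ε < 1) :
    mixDist d n ε = ∫ ω, expDefect (√(n : ℝ) * logSlope d ε *
      ((√(n : ℝ))⁻¹ * ∑ k ∈ Finset.range n, score d (ω k)) + n * logMean d ε) ∂(unifSeq d) := by
  have hs : √(n : ℝ) ≠ 0 := (Real.sqrt_pos.2 (by exact_mod_cast hn)).ne'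
  have hmap : (unifSeq d).map (fun ω (i : Fin n) => ω i) =
      Measure.infinitePi fun _ : Fin n => uniformOn (Set.univ : Set (ZMod d)) :=
    Measure.map_infinitePi_infinitePi_of_inj (P := fun _ : ℕ => uniformOn (Set.univ : Set (ZMod d)))
      Fin.val_injective
  let f : State d n → ℝ := fun x =>
    expDefect (logSlope d ε * ∑ i, score d (x i) + n * logMean d ε)
  have hf : ∀ ω : ℕ → ZMod d, expDefect (√(n : ℝ) * logSlope d ε *
      ((√(n : ℝ))⁻¹ * ∑ k ∈ Finset.range n, score d (ω k)) + n * logMean d ε) =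
      f (fun i => ω i) := by
    intro ω
    simp only [f]
    rw [Finset.sum_range]
    congr 2
    field_simp
  simp_rw [hf]
  rw [← integral_map (φ := fun (ω : ℕ → ZMod d) (i : Fin n) => ω i) (f := f)
    (measurable_pi_lambda _ fun i => measurable_pi_apply _).aemeasurable
    (Measurable.of_discrete (f := f)).aestronglyMeasurable, hmap, integral_fintype .of_finite]
  refine Finset.sum_congr rfl fun x _ => ?_
  have hsing : (Measure.infinitePi fun _ : Fin n => uniformOn (Set.univ : Set (ZMod d))).real {x} =
      ((d : ℝ)⁻¹) ^ n := by
    rw [measureReal_def, Measure.infinitePi_singleton_of_fintype]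
    simp [uniformOn_univ]
  have hd0 : (0 : ℝ) ≤ ((d : ℝ)⁻¹) ^ n := by positivity
  rw [hsing, smul_eq_mul]
  simp only [f]
  rw [expDefect_apply, mul_max_of_nonneg _ _ hd0, mul_zero, mul_sub, mul_one]
  simp_rw [mixLaw_eq_exp hd h0 h1]
  rw [Finset.prod_mul_distrib, ← Real.exp_sum, Finset.sum_add_distrib, ← Finset.mul_sum]
  simp

theorem tendsto_sqrt_mul_logSlope (a : ℝ) :
    Tendsto (fun n : ℕ => √(n : ℝ) * logSlope d (a / √(n : ℝ))) atTop
      (𝓝 (√((d : ℝ) - 1) * a)) := by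
  have hd := natCast_pos_of_neZero (d := d)
  have h := ((tendsto_sqrt_mul_log ((d - 1) * a)).sub (tendsto_sqrt_mul_log (-a))).const_mul
    (√((d : ℝ) - 1) / d)
  convert h using 2
  · simp only [logSlope, neg_div, ← sub_eq_add_neg, mul_div_assoc]
    ring
  · field_simp
    ring

-- The terms of order `√n` cancel, since `-(1 - 1/d) a + (d-1) a / d = 0`; the quadratic ones add up
-- to `-(d-1) a²/2`.
omit [NeZero d] in
theorem tendsto_natCast_mul_logMean (hd : 2 ≤ d) (a : ℝ) :
    Tendsto (fun n : ℕ => n * logMean d (a / √(n : ℝ))) atTop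
      (𝓝 (-((√((d : ℝ) - 1) * a) ^ 2 / 2))) := by
  have hd' : (2 : ℝ) ≤ d := by exact_mod_cast hd
  have hd0 : (d : ℝ) ≠ 0 := by linarith
  have h := ((tendsto_natCast_mul_log_sub (-a)).const_mul (1 - 1 / (d : ℝ))).add
    ((tendsto_natCast_mul_log_sub ((d - 1) * a)).const_mul (1 / (d : ℝ)))
  convert h using 2
  · simp only [logMean, neg_div, ← sub_eq_add_neg, mul_div_assoc]
    field_simp
    ring
  · rw [mul_pow, Real.sq_sqrt (by linarith)]
    field_simp
    ring

/-- The distance from uniformity of the product of `n` copies of `mixLaw d (a / √n)`. -/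
theorem tendsto_mixDist (hd : 2 ≤ d) {a : ℝ} (ha : 0 ≤ a) :
    Tendsto (fun n : ℕ => mixDist d n (a / √(n : ℝ))) atTop
      (𝓝 (2 * stdNormalCDF (√((d : ℝ) - 1) * a / 2) - 1)) := by
  set s := √((d : ℝ) - 1) * a with hs
  have hcoef : Tendsto (fun n : ℕ => (√(n : ℝ) * logSlope d (a / √(n : ℝ)),
      n * logMean d (a / √(n : ℝ)))) atTop (𝓝 (s, -(s ^ 2 / 2))) :=
    (tendsto_sqrt_mul_logSlope a).prodMk_nhds (tendsto_natCast_mul_logMean hd a)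
  -- Slutsky's lemma, with the deterministic coefficients viewed as constant random variables.
  have hdist := (tendstoInDistribution_score hd).continuous_comp_prodMk_of_tendstoInMeasure_const
    (g := fun p : ℝ × (ℝ × ℝ) => p.2.1 * p.1 + p.2.2) (by fun_prop)
    (Y := fun (n : ℕ) (_ : ℕ → ZMod d) => (√(n : ℝ) * logSlope d (a / √(n : ℝ)),
      n * logMean d (a / √(n : ℝ))))
    (tendstoInMeasure_of_tendsto_ae (fun _ => aestronglyMeasurable_const)
      (Eventually.of_forall fun _ => hcoef))
    (fun _ => aemeasurable_const)
  have hlim := ProbabilityMeasure.tendsto_iff_forall_integral_tendsto.1 hdist.tendsto expDefect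
  simp only [ProbabilityMeasure.coe_mk] at hlim
  rw [integral_map hdist.aemeasurable_limit
    expDefect.continuous.measurable.aestronglyMeasurable] at hlim
  simp_rw [id, ← sub_eq_add_neg] at hlim
  rw [integral_expDefect_gaussian (mul_nonneg (Real.sqrt_nonneg _) ha)] at hlim
  refine hlim.congr' ?_
  have hsmall : Tendsto (fun n : ℕ => a / √(n : ℝ)) atTop (𝓝 0) :=
    tendsto_const_nhds.div_atTop tendsto_sqrt_natCast_atTop
  filter_upwards [eventually_gt_atTop 0, hsmall.eventually_lt_const zero_lt_one] with n hn hn1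
  rw [integral_map (hdist.forall_aemeasurable n)
    expDefect.continuous.measurable.aestronglyMeasurable,
    mixDist_eq_integral hd hn (by positivity) hn1]

end CLT

/-! ### Times near the cutoff -/

section Times

variable {d : ℕ}

theorem exp_cutoffTime (hd : 2 ≤ d) {n : ℕ} (hn : 0 < n) (c θ : ℝ) :
    Real.exp (-(d * (c * cutoffTime d n + θ) / ((d : ℝ) - 1))) =
      Real.exp (-(d * θ / ((d : ℝ) - 1))) * (n : ℝ) ^ ((1 - c) / 2) / √(n : ℝ) := by
  have hd' : (2 : ℝ) ≤ d := by exact_mod_cast hd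
  have hne : (d : ℝ) - 1 ≠ 0 := by linarith
  have hne' : (d : ℝ) ≠ 0 := by linarith
  have hn' : (0 : ℝ) < n := by exact_mod_cast hn
  rw [Real.sqrt_eq_rpow, mul_div_assoc (Real.exp _), ← Real.rpow_sub hn', Real.rpow_def_of_pos hn',
    ← Real.exp_add, cutoffTime]
  congr 1
  field_simp
  ring

theorem cutoffTime_nonneg (hd : 2 ≤ d) (n : ℕ) : 0 ≤ cutoffTime d n := by
  have hd' : (2 : ℝ) ≤ d := by exact_mod_cast hd
  refine mul_nonneg (mul_nonneg (by norm_num) (div_nonneg (by linarith) (by linarith))) ?_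
  exact Real.log_natCast_nonneg n

theorem tendsto_cutoffTime (hd : 2 ≤ d) : Tendsto (fun n => cutoffTime d n) atTop atTop := by
  have hd' : (2 : ℝ) ≤ d := by exact_mod_cast hd
  refine Tendsto.const_mul_atTop ?_ (Real.tendsto_log_atTop.comp tendsto_natCast_atTop_atTop)
  exact mul_pos (by norm_num) (div_pos (by linarith) (by linarith))

end Times

/-! ### Extreme regimes by monotone comparison -/

section MixCutoff

variable {d : ℕ} [NeZero d]

theorem tendsto_mixDist_one (hd : 2 ≤ d) {b : ℕ → ℝ} (hb : Tendsto b atTop atTop)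
    (h1 : ∀ n, b n / √(n : ℝ) ≤ 1) :
    Tendsto (fun n : ℕ => mixDist d n (b n / √(n : ℝ))) atTop (𝓝 1) := by
  have hd' : (2 : ℝ) ≤ d := by exact_mod_cast hd
  have hlim : Tendsto (fun a : ℝ => 2 * stdNormalCDF (√((d : ℝ) - 1) * a / 2) - 1) atTop (𝓝 1) :=
    tendsto_two_mul_stdNormalCDF_atTop.comp
      (tendsto_id.const_mul_atTop (Real.sqrt_pos.2 (by linarith)))
  refine tendsto_order.2 ⟨fun y hy => ?_, fun y hy => ?_⟩
  · obtain ⟨a, hay, ha⟩ := ((hlim.eventually_const_lt hy).and (eventually_ge_atTop 0)).exists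
    filter_upwards [(tendsto_mixDist hd ha).eventually_const_lt hay, hb.eventually_ge_atTop a]
      with n hn hab
    exact hn.trans_le (mixDist_mono n (by positivity) (by gcongr))
  · filter_upwards [hb.eventually_ge_atTop 0] with n hn
    exact (mixDist_le_one n (by positivity) (h1 n)).trans_lt hy

theorem tendsto_mixDist_zero (hd : 2 ≤ d) {b : ℕ → ℝ} (hb : Tendsto b atTop (𝓝 0))
    (h0 : ∀ n, 0 ≤ b n) :
    Tendsto (fun n : ℕ => mixDist d n (b n / √(n : ℝ))) atTop (𝓝 0) := by
  have hd' : (2 : ℝ) ≤ d := by exact_mod_cast hd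
  -- The comparison value `a` must be strictly positive for `b n ≤ a` to hold eventually.
  have hscale : Tendsto (fun a : ℝ => √((d : ℝ) - 1) * a) (𝓝[>] 0) (𝓝[≥] 0) := by
    refine tendsto_nhdsWithin_iff.2 ⟨?_, ?_⟩
    · have : Continuous fun a : ℝ => √((d : ℝ) - 1) * a := by fun_prop
      simpa using (this.tendsto 0).mono_left nhdsWithin_le_nhds
    · filter_upwards [self_mem_nhdsWithin] with a ha
      exact mul_nonneg (Real.sqrt_nonneg _) (le_of_lt ha)
  have hlim := tendsto_two_mul_stdNormalCDF_zero.comp hscale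
  refine tendsto_order.2 ⟨fun y hy => ?_, fun y hy => ?_⟩
  · exact Eventually.of_forall fun n => hy.trans_le (mixDist_nonneg n _)
  · obtain ⟨a, hay, ha⟩ := ((hlim.eventually_lt_const hy).and self_mem_nhdsWithin).exists
    have ha : 0 < a := ha
    filter_upwards [(tendsto_mixDist hd ha.le).eventually_lt_const hay,
      hb.eventually_le_const ha] with n hn hab
    exact (mixDist_mono n (div_nonneg (h0 n) (Real.sqrt_nonneg _)) (by gcongr)).trans_lt hn

end MixCutoff

end CompleteGraphWalk

theorem lemma4p1 (d : ℕ) (hd : 2 ≤ d)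
    (Ω : ℕ → Type*) [∀ n, MeasurableSpace (Ω n)]
    (P : ∀ n, Measure (Ω n)) [∀ n, IsProbabilityMeasure (P n)]
    (N : ∀ n, Fin n → ℝ≥0 → Ω n → ℕ) (m : ∀ n, Fin n → ℕ → Ω n → ℕ)
    (hΛ : ∀ n, CompleteGraphWalk.IsIndepMarkedPoissonFamily (P n) d n (N n) (m n)) :
    (∀ θ : ℝ,
      Tendsto
        (fun n : ℕ => CompleteGraphWalk.distToEquilibrium (P n) d n (N n) (m n)
          (CompleteGraphWalk.cutoffTime d n + θ))
        atTop
        (𝓝 (2 * CompleteGraphWalk.stdNormalCDF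
          (Real.sqrt ((d : ℝ) - 1) / 2 * Real.exp (-(d * θ / ((d : ℝ) - 1)))) - 1))) ∧
    CompleteGraphWalk.HasCutoff
      (fun n t => CompleteGraphWalk.distToEquilibrium (P n) d n (N n) (m n) t)
      (fun n => CompleteGraphWalk.cutoffTime d n) := by
  open CompleteGraphWalk in
  have : NeZero d := ⟨by omega⟩
  have hdist : ∀ (n : ℕ) (c : ℝ), 0 ≤ c → 0 < n →
      distToEquilibrium (P n) d n (N n) (m n) (c * cutoffTime d n) =
        mixDist d n ((n : ℝ) ^ ((1 - c) / 2) / √(n : ℝ)) := by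
    intro n c hc hn
    rw [distToEquilibrium_eq_mixDist hd (hΛ n) (mul_nonneg hc (cutoffTime_nonneg hd n))]
    have h := exp_cutoffTime hd hn c 0
    rw [add_zero, mul_zero, zero_div, neg_zero, Real.exp_zero, one_mul] at h
    rw [h]
  refine ⟨fun θ => ?_, fun c hc0 hc1 => ?_, fun c hc => ?_⟩
  · have h := tendsto_mixDist hd (Real.exp_pos (-(d * θ / ((d : ℝ) - 1)))).le
    rw [mul_div_right_comm (√_)] at h
    refine h.congr' ?_
    filter_upwards [(tendsto_cutoffTime hd).eventually_ge_atTop (-θ), eventually_gt_atTop 0]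
      with n hn hn0
    rw [distToEquilibrium_eq_mixDist hd (hΛ n) (by linarith)]
    have h := exp_cutoffTime hd hn0 1 θ
    rw [one_mul, sub_self, zero_div, Real.rpow_zero, mul_one] at h
    rw [h]
  · have h := tendsto_mixDist_one hd (b := fun n => (n : ℝ) ^ ((1 - c) / 2))
      ((tendsto_rpow_atTop (by linarith)).comp tendsto_natCast_atTop_atTop) fun n => by
        refine div_le_one_of_le₀ ?_ (Real.sqrt_nonneg _)
        -- The bound is required for every `n`; at `n = 0` the power vanishes because its exponent
        -- is nonzero.
        rcases n.eq_zero_or_pos with rfl | hn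
        · simp [Real.zero_rpow (show (1 - c) / 2 ≠ 0 by linarith)]
        · rw [Real.sqrt_eq_rpow]
          exact Real.rpow_le_rpow_of_exponent_le (by exact_mod_cast hn) (by linarith)
    refine h.congr' ?_
    filter_upwards [eventually_gt_atTop 0] with n hn
    exact (hdist n c hc0.le hn).symm
  · have hb : Tendsto (fun n : ℕ => (n : ℝ) ^ ((1 - c) / 2)) atTop (𝓝 0) := by
      have := (tendsto_rpow_neg_atTop (show 0 < (c - 1) / 2 by linarith)).comp
        (tendsto_natCast_atTop_atTop (R := ℝ))
      rwa [show -((c - 1) / 2) = (1 - c) / 2 by ring] at this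
    have h := tendsto_mixDist_zero hd hb fun n => by positivity
    refine h.congr' ?_
    filter_upwards [eventually_gt_atTop 0] with n hn
    exact (hdist n c (by linarith) hn).symm
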